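/- Write points of $\mathbb R^2\times\mathbb R^2$ as $(t_1,z_1,t_2,z_2)$ and let $\Omega=\{(t_1-t_2)^2<(z_1-z_2)^2\}$, which is the disjoint union of $\Omega_1=\Omega\cap\{z_1<z_2\}$ and $\Omega_2=\Omega\cap\{z_1>z_2\}$. Let $k\ge 1$ be an integer and let $\psi=(\psi_1,\psi_2,\psi_3,\psi_4):\Omega\to\mathbb C^2\otimes\mathbb C^2$ (components with respect to $e_1\otimes e_1,\,e_1\otimes e_2,\,e_2\otimes e_1,\,e_2\otimes e_2$) be a $C^k$ solution on $\Omega$ of the two-time Dirac equations $$i\partial_{t_1}\psi=-i(\sigma_3\otimes 1)\,\partial_{z_1}\psi,\qquad i\partial_{t_2}\psi=-i(1\otimes\sigma_3)\,\partial_{z_2}\psi ,\qquad \sigma_3=\mathrm{diag}(1,-1),$$ with initial values $\psi(0,z_1,0,z_2)=g^{(1)}(z_1,z_2)$ for $z_1<z_2$ and $\psi(0,z_1,0,z_2)=g^{(2)}(z_1,z_2)$ for $z_1>z_2$, where $g^{(1)}$, $g^{(2)}$ are $C^k$ on the closed half-planes $\{z_1\le z_2\}$, $\{z_1\ge z_2\}$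 respectively and vanish outside a compact set. Let $\gamma^0=\sigma_1=\begin{pmatrix}0&1\\1&0\end{pmatrix}$, $\gamma^1=\sigma_1\sigma_3$, $\gamma_1^\mu=\gamma^\mu\otimes 1$, $\gamma_2^\nu=1\otimes\gamma^\nu$, $j^{\mu\nu}=\psi^\dagger\gamma_1^0\gamma_2^0\,\gamma_1^\mu\gamma_2^\nu\,\psi$ ($\mu,\nu\in\{0,1\}$), let $\varepsilon_{\mu\nu}$ be the Levi-Civita symbol, so that $\varepsilon_{\mu\nu}j^{\mu\nu}=j^{01}-j^{10}$, and let $$\omega_j=j^{00}\,dz_1\wedge dz_2-j^{01}\,dz_1\wedge dt_2-j^{10}\,dt_1\wedge dz_2+j^{11}\,dt_1\wedge dt_2 .$$ For a function $f$ on $\Omega$ write $f(t,z\mp0,t,z\pm0)=\lim_{\epsilon\downarrow0}f(t,z\mp\epsilon,t,z\pm\epsilon)$; the upper signs give the limit from $\Omega_1$, the lower signs the limit from $\Omega_2$. A space-like Cauchy surface is a graph $\Sigma=\{(t_\Sigma(z),z):z\in\mathbb R\}$ with $t_\Sigma:\mathbb R\to\mathbb R$ smooth, $|t_\Sigma'(z)|<1$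 for all $z$, that meets every light ray $\{(t_0+s,z_0\pm s):s\in\mathbb R\}$. Integrals over $(\Sigma\times\Sigma)\cap\Omega$ use the orientation $dz_1\wedge dz_2$. Then: 1. (Probability conservation.) If for all $t,z\in\mathbb R$ $$\varepsilon_{\mu\nu}j^{\mu\nu}(t,z-0,t,z+0)=0\qquad\text{and}\qquad \varepsilon_{\mu\nu}j^{\mu\nu}(t,z+0,t,z-0)=0,$$ then $\int_{(\Sigma\times\Sigma)\cap\Omega}\omega_j$ converges absolutely and has the same value for every space-like Cauchy surface $\Sigma$. 2. (Equivalent linear conditions.) The first condition $\varepsilon_{\mu\nu}j^{\mu\nu}(t,z-0,t,z+0)=0$ for all $t,z$ holds if and only if there is a function $\theta_1:\mathbb R^2\to[-\pi,\pi)$ with $$\psi_2(t,z-0,t,z+0)=e^{-i\theta_1(t,z)}\,\psi_3(t,z-0,t,z+0)\quad\text{for all }t,z ,$$ and the second holds if and only if there is a function $\theta_2:\mathbb R^2\to[-\pi,\pi)$ with $$\psi_2(t,z+0,t,z-0)=e^{-i\theta_2(t,z)}\,\psi_3(t,z+0,t,z-0)\quad\text{for all }t,z .$$ 3. (Regularity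 of the phases.) Whenever $\theta_1$, $\theta_2$ are such functions, $e^{-i\theta_1}$ is $C^k$ near every $(t,z)$ with $\psi_3(t,z-0,t,z+0)\ne0$, and $e^{-i\theta_2}$ is $C^k$ near every $(t,z)$ with $\psi_3(t,z+0,t,z-0)\ne0$. -/

import Mathlib

open scoped ContDiff Topology Kronecker Matrix

noncomputable section

namespace TwoTimeDirac

/-! ### Configurations -/

/-- Points `(t, z)` of (1+1)-dimensional Minkowski space-time, `g = diag (1, -1)`. -/
abbrev Spacetime : Type := ℝ × ℝ

/-- Pairs of space-time points `((t₁, z₁), (t₂, z₂))`. -/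
abbrev Config : Type := Spacetime × Spacetime

/-- `ℂ² ⊗ ℂ²`, through its components with respect to the basis `e_a ⊗ e_b`. In the ordering
`e₁ ⊗ e₁, e₁ ⊗ e₂, e₂ ⊗ e₁, e₂ ⊗ e₂` the components `ψ₁, ψ₂, ψ₃, ψ₄` of `ψ` are
`ψ (0, 0)`, `ψ (0, 1)`, `ψ (1, 0)`, `ψ (1, 1)`. -/
abbrev Spinor : Type := Fin 2 × Fin 2 → ℂ

/-- The space-like configurations. -/
def Omega : Set Config :=
  {p | (p.1.1 - p.2.1) ^ 2 - (p.1.2 - p.2.2) ^ 2 < 0}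

/-! ### The two-time Dirac equations -/

/-- The Pauli matrix `σ₁`. -/
def sigma1 : Matrix (Fin 2) (Fin 2) ℂ := !![0, 1; 1, 0]

/-- The Pauli matrix `σ₃`. -/
def sigma3 : Matrix (Fin 2) (Fin 2) ℂ := !![1, 0; 0, -1]

/-- `ψ` is a `C^k` solution on the set of space-like configurations of the free massless two-time
Dirac equations
`i ∂_{t₁} ψ = -i (σ₃ ⊗ 1) ∂_{z₁} ψ` and `i ∂_{t₂} ψ = -i (1 ⊗ σ₃) ∂_{z₂} ψ`,
with initial values `g₁` at `t₁ = t₂ = 0`, `z₁ < z₂` and `g₂` at `t₁ = t₂ = 0`, `z₁ > z₂`.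
Values of `ψ` outside `Omega` are irrelevant. -/
structure IsSolution (k : ℕ) (g₁ g₂ : ℝ × ℝ → Spinor) (ψ : Config → Spinor) : Prop where
  contDiffOn : ContDiffOn ℝ k ψ Omega
  dirac₁ : ∀ p ∈ Omega,
    Complex.I • fderiv ℝ ψ p ((1, 0), (0, 0)) =
      -Complex.I • ((sigma3 ⊗ₖ (1 : Matrix (Fin 2) (Fin 2) ℂ)) *ᵥ
        fderiv ℝ ψ p ((0, 1), (0, 0)))
  dirac₂ : ∀ p ∈ Omega,
    Complex.I • fderiv ℝ ψ p ((0, 0), (1, 0)) =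
      -Complex.I • (((1 : Matrix (Fin 2) (Fin 2) ℂ) ⊗ₖ sigma3) *ᵥ
        fderiv ℝ ψ p ((0, 0), (0, 1)))
  initial₁ : ∀ z₁ z₂ : ℝ, z₁ < z₂ → ψ ((0, z₁), (0, z₂)) = g₁ (z₁, z₂)
  initial₂ : ∀ z₁ z₂ : ℝ, z₂ < z₁ → ψ ((0, z₁), (0, z₂)) = g₂ (z₁, z₂)

/-- Initial data on the closed half-plane `H` of pairs `(z₁, z₂)`: of class `C^k` up to the
boundary, and zero outside a compact set. -/
def IsInitialDatum (k : ℕ) (H : Set (ℝ × ℝ)) (g : ℝ × ℝ → Spinor) : Prop :=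
  ContDiffOn ℝ k g H ∧ ∃ K : Set (ℝ × ℝ), IsCompact K ∧ ∀ q ∈ H, q ∉ K → g q = 0

/-! ### The tensor current -/

/-- `γ⁰ = σ₁`, `γ¹ = σ₁ σ₃`. -/
def gamma : Fin 2 → Matrix (Fin 2) (Fin 2) ℂ := ![sigma1, sigma1 * sigma3]

/-- `γ₁^μ = γ^μ ⊗ 1`. -/
def gammaFst (μ : Fin 2) : Matrix (Fin 2 × Fin 2) (Fin 2 × Fin 2) ℂ :=
  gamma μ ⊗ₖ (1 : Matrix (Fin 2) (Fin 2) ℂ)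

/-- `γ₂^ν = 1 ⊗ γ^ν`. -/
def gammaSnd (ν : Fin 2) : Matrix (Fin 2 × Fin 2) (Fin 2 × Fin 2) ℂ :=
  (1 : Matrix (Fin 2) (Fin 2) ℂ) ⊗ₖ gamma ν

/-- The Dirac adjoint `ψ̄ = ψ† γ₁⁰ γ₂⁰` (a row vector). -/
def diracAdjoint (s : Spinor) : Spinor := star s ᵥ* (gammaFst 0 * gammaSnd 0)

/-- The tensor current `j^{μν} = ψ̄ γ₁^μ γ₂^ν ψ`. -/
def current (ψ : Config → Spinor) (μ ν : Fin 2) (p : Config) : ℂ :=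
  diracAdjoint (ψ p) ⬝ᵥ ((gammaFst μ * gammaSnd ν) *ᵥ ψ p)

/-- The Levi-Civita symbol `ε_{μν}` with `ε_{01} = 1`. -/
def leviCivita : Matrix (Fin 2) (Fin 2) ℂ := !![0, 1; -1, 0]

/-- `ε_{μν} j^{μν}`. -/
def antisymCurrent (ψ : Config → Spinor) (p : Config) : ℂ :=
  ∑ μ, ∑ ν, leviCivita μ ν * current ψ μ ν p

/-! ### The current form and its integrals -/

/-- `d x^μ` on space-time: `d x⁰ = d t`, `d x¹ = d z`. -/
def dx : Fin 2 → Spacetime →ₗ[ℝ] ℝ := ![LinearMap.fst ℝ ℝ ℝ, LinearMap.snd ℝ ℝ ℝ]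

/-- The wedge product of two covectors, `(α ∧ β) (u, v) = α u * β v - β u * α v`. -/
def wedge (α β : Config →ₗ[ℝ] ℝ) : Config [⋀^Fin 2]→ₗ[ℝ] ℝ :=
  Matrix.detRowAlternating.compLinearMap (LinearMap.pi ![α, β])

theorem wedge_apply (α β : Config →ₗ[ℝ] ℝ) (u v : Config) :
    wedge α β ![u, v] = α u * β v - β u * α v := by
  change Matrix.det (Matrix.of fun i => LinearMap.pi ![α, β] (![u, v] i)) = _
  rw [Matrix.det_fin_two]
  simp

/-- The current form
`ω_j = ∑_{μ,ν} (-1)^μ (-1)^ν j^{μν} d x₁^{1-μ} ∧ d x₂^{1-ν}`, i.e.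
`j⁰⁰ dz₁ ∧ dz₂ - j⁰¹ dz₁ ∧ dt₂ - j¹⁰ dt₁ ∧ dz₂ + j¹¹ dt₁ ∧ dt₂`. -/
def currentForm (ψ : Config → Spinor) (p : Config) : Config [⋀^Fin 2]→ₗ[ℝ] ℂ :=
  ∑ μ : Fin 2, ∑ ν : Fin 2,
    ((-1) ^ (μ : ℕ) * (-1) ^ (ν : ℕ) * current ψ μ ν p) •
      Complex.ofRealCLM.toLinearMap.compAlternatingMap
        (wedge (dx (1 - μ) ∘ₗ LinearMap.fst ℝ Spacetime Spacetime)
          (dx (1 - ν) ∘ₗ LinearMap.snd ℝ Spacetime Spacetime))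

/-- A space-like hypersurface `Σ`: the graph `t = time z` of a smooth function whose tangent vectors
`(time' z, 1)` are all space-like. It is moreover required to be a Cauchy surface, i.e. every
light ray meets `Σ` (for a space-like graph this amounts to every inextendible causal curve
meeting `Σ`). -/
structure SpacelikeCauchySurface where
  /-- The time coordinate of the point of `Σ` with spatial coordinate `z`. -/
  time : ℝ → ℝ
  smooth : ContDiff ℝ ∞ time
  spacelike : ∀ z, |deriv time z| < 1
  meets_right : ∀ t₀ z₀ : ℝ, ∃ s : ℝ, time (z₀ + s) = t₀ + s
  meets_left : ∀ t₀ z₀ : ℝ, ∃ s : ℝ, time (z₀ - s) = t₀ + s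

/-- The parametrization `(z₁, z₂) ↦ ((t_Σ(z₁), z₁), (t_Σ(z₂), z₂))` of `Σ × Σ`. -/
def SpacelikeCauchySurface.param (S : SpacelikeCauchySurface) (q : ℝ × ℝ) : Config :=
  ((S.time q.1, q.1), (S.time q.2, q.2))

/-- The parameters of the points of `(Σ × Σ) ∩ Ω`. -/
def SpacelikeCauchySurface.domain (S : SpacelikeCauchySurface) : Set (ℝ × ℝ) :=
  {q | S.param q ∈ Omega}

/-- The coefficient of `dz₁ ∧ dz₂` in the pull-back of a 2-form to `Σ × Σ`. -/
def SpacelikeCauchySurface.pullback (S : SpacelikeCauchySurface)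
    (w : Config → Config [⋀^Fin 2]→ₗ[ℝ] ℂ) (q : ℝ × ℝ) : ℂ :=
  w (S.param q) ![fderiv ℝ S.param q (1, 0), fderiv ℝ S.param q (0, 1)]

/-- The integral of a 2-form over `(Σ × Σ) ∩ Ω`, oriented by `dz₁ ∧ dz₂`. -/
def SpacelikeCauchySurface.integral (S : SpacelikeCauchySurface)
    (w : Config → Config [⋀^Fin 2]→ₗ[ℝ] ℂ) : ℂ :=
  ∫ q in S.domain, S.pullback w q

/-- Probability conservation: the integral of `ω_j` over `(Σ × Σ) ∩ Ω` converges absolutely for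
every space-like Cauchy surface `Σ`, and its value does not depend on `Σ`. -/
def ProbabilityConserved (ψ : Config → Spinor) : Prop :=
  (∀ S : SpacelikeCauchySurface,
    MeasureTheory.IntegrableOn (S.pullback (currentForm ψ)) S.domain) ∧
  ∀ S S' : SpacelikeCauchySurface, S.integral (currentForm ψ) = S'.integral (currentForm ψ)

/-! ### Conditions at the coincidence points -/

/-- `f (t, z-0, t, z+0) = v`: the limit at `(t, z, t, z)` from `Ω₁` (the part `z₁ < z₂` of `Ω`)
exists and equals `v`. -/
def HasLimit₁ {X : Type*} [TopologicalSpace X] (f : Config → X) (t z : ℝ) (v : X) : Prop :=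
  Filter.Tendsto (fun ε : ℝ => f ((t, z - ε), (t, z + ε))) (𝓝[>] 0) (𝓝 v)

/-- `f (t, z+0, t, z-0) = v`: the limit at `(t, z, t, z)` from `Ω₂` (the part `z₁ > z₂` of `Ω`)
exists and equals `v`. -/
def HasLimit₂ {X : Type*} [TopologicalSpace X] (f : Config → X) (t z : ℝ) (v : X) : Prop :=
  Filter.Tendsto (fun ε : ℝ => f ((t, z + ε), (t, z - ε))) (𝓝[>] 0) (𝓝 v)

/-- `ε_{μν} j^{μν} (t, z-0, t, z+0) = 0` for all `t, z`. -/
def CurrentCondition₁ (ψ : Config → Spinor) : Prop :=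
  ∀ t z : ℝ, HasLimit₁ (antisymCurrent ψ) t z 0

/-- `ε_{μν} j^{μν} (t, z+0, t, z-0) = 0` for all `t, z`. -/
def CurrentCondition₂ (ψ : Config → Spinor) : Prop :=
  ∀ t z : ℝ, HasLimit₂ (antisymCurrent ψ) t z 0

/-- `ψ₂ (t, z-0, t, z+0) = e^{-i θ(t,z)} ψ₃ (t, z-0, t, z+0)` for all `t, z`. -/
def LinearCondition₁ (θ : ℝ × ℝ → ℝ) (ψ : Config → Spinor) : Prop :=
  ∀ t z : ℝ, ∃ a b : ℂ, HasLimit₁ (fun p => ψ p (0, 1)) t z a ∧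
    HasLimit₁ (fun p => ψ p (1, 0)) t z b ∧ a = Complex.exp (-Complex.I * θ (t, z)) * b

/-- `ψ₂ (t, z+0, t, z-0) = e^{-i θ(t,z)} ψ₃ (t, z+0, t, z-0)` for all `t, z`. -/
def LinearCondition₂ (θ : ℝ × ℝ → ℝ) (ψ : Config → Spinor) : Prop :=
  ∀ t z : ℝ, ∃ a b : ℂ, HasLimit₂ (fun p => ψ p (0, 1)) t z a ∧
    HasLimit₂ (fun p => ψ p (1, 0)) t z b ∧ a = Complex.exp (-Complex.I * θ (t, z)) * b

/-- A phase function, with values in `[-π, π)`. -/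
def IsPhaseFunction (θ : ℝ × ℝ → ℝ) : Prop :=
  ∀ q, θ q ∈ Set.Ico (-Real.pi) Real.pi

end TwoTimeDirac

end

noncomputable section
namespace TwoTimeDirac

/-! ### Null coordinates -/

/-! In null coordinates `u = z - t`, `v = z + t`, each component of `ψ` is transported: on either
convex half of `Ω`, `ψ₁` depends only on `(u₁, u₂)`, `ψ₄` on `(v₁, v₂)`, `ψ₂ = H (u₁, v₂)` and `ψ₃ =
K (u₂, v₁)`. Each half of `Ω` constrains `u₂ - u₁` and `v₂ - v₁` only, so `H` and `K` live on the
whole plane (`IsSolution.exists_profiles`), and the coincidence limits at `(t, z)` are `H` and `K`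
at `(z - t, z + t)`.

Since `ε_{μν} j^{μν} = 2 (|ψ₃|² - |ψ₂|²)`, the current condition says exactly `|H| = |K|`
everywhere. This is equality up to a phase, and where `K ≠ 0` the phase factor is `H / K`, hence
`C^k`.

On `Σ × Σ` the form `ω_j` has density `∑ |ψ_{ab}|² n_a'(z₁) n_b'(z₂)`, with `n₀ = u`, `n₁ = v` along
`Σ`. Substituting null coordinates turns the `ψ₁` and `ψ₄` terms into half-plane integrals of the
initial data. The `ψ₂` and `ψ₃` terms are conserved only jointly: by `|K| = |H|` and the swap `z₁ ↔
z₂`, the `ψ₃` term is the `ψ₂` integrand on the opposite half-plane, and together they give `∫ |H|²`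
over the plane (`integral_density_halfPlane`). -/

/-- The eigenvalues of `σ₃`. -/
def chirality : Fin 2 → ℝ := ![1, -1]

/-- The null coordinates `z - t` (index `0`) and `z + t` (index `1`). -/
def nullCoord (a : Fin 2) (x : Spacetime) : ℝ := x.2 - chirality a * x.1

@[simp] theorem nullCoord_zero (x : Spacetime) : nullCoord 0 x = x.2 - x.1 := by
  simp [nullCoord, chirality]

@[simp] theorem nullCoord_one (x : Spacetime) : nullCoord 1 x = x.2 + x.1 := by
  simp [nullCoord, chirality]

/-- The space-time point with null coordinates `u = z - t`, `v = z + t`. -/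
def ofNull (u v : ℝ) : Spacetime := ((v - u) / 2, (u + v) / 2)

@[simp] theorem nullCoord_zero_ofNull (u v : ℝ) : (ofNull u v).2 - (ofNull u v).1 = u := by
  simp [ofNull]; ring

@[simp] theorem nullCoord_one_ofNull (u v : ℝ) : (ofNull u v).2 + (ofNull u v).1 = v := by
  simp [ofNull]; ring

/-- For `σ > 0` this is `Ω₁`, for `σ < 0` it is `Ω₂`. -/
def region (σ : ℝ) : Set Config :=
  {p | 0 < σ * (nullCoord 0 p.2 - nullCoord 0 p.1) ∧
    0 < σ * (nullCoord 1 p.2 - nullCoord 1 p.1)}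

/-- The two null differences multiply to `(z₁ - z₂)² - (t₁ - t₂)²`, so the product of the defining
inequalities is `σ²` times this. -/
theorem region_subset_Omega (σ : ℝ) : region σ ⊆ Omega := by
  rintro p ⟨h0, h1⟩
  simp only [nullCoord_zero, nullCoord_one] at h0 h1
  have h := mul_pos h0 h1
  simp only [Omega, Set.mem_ofPred_eq]
  by_contra hc
  nlinarith [mul_nonneg (sq_nonneg σ) (not_lt.1 hc)]

theorem convex_region (σ : ℝ) : Convex ℝ (region σ) := by
  rintro p ⟨hp0, hp1⟩ q ⟨hq0, hq1⟩ a b ha hb hab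
  simp only [nullCoord_zero, nullCoord_one] at hp0 hp1 hq0 hq1
  have key : ∀ x y : ℝ, 0 < x → 0 < y → 0 < a * x + b * y := fun x y hx hy => by
    rcases ha.eq_or_lt with rfl | ha'
    · have : b = 1 := by linarith
      simpa [this] using hy
    · positivity
  constructor
  · convert key _ _ hp0 hq0 using 1
    simp; ring
  · convert key _ _ hp1 hq1 using 1
    simp; ring

theorem isOpen_Omega : IsOpen Omega := by
  refine isOpen_lt ?_ ?_ <;> fun_prop

/-- A function is constant along a segment on which its directional derivative vanishes. -/
theorem eq_of_fderiv_sub_eq_zero {E : Type*} [NormedAddCommGroup E] [NormedSpace ℝ E]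
    {F : Type*} [NormedAddCommGroup F] [NormedSpace ℝ F]
    {f : E → F} {W : Set E} (hW : Convex ℝ W) {p q : E} (hp : p ∈ W) (hq : q ∈ W)
    (hf : ∀ x ∈ W, DifferentiableAt ℝ f x) (h0 : ∀ x ∈ W, fderiv ℝ f x (q - p) = 0) :
    f p = f q := by
  have hmem : ∀ s ∈ Set.Icc (0 : ℝ) 1, AffineMap.lineMap p q s ∈ W := fun s hs =>
    hW.lineMap_mem hp hq hs
  have hd : ∀ s ∈ Set.Icc (0 : ℝ) 1,
      HasDerivAt (fun s : ℝ => f (AffineMap.lineMap p q s)) 0 s := fun s hs => by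
    have h1 := (hf _ (hmem s hs)).hasFDerivAt.comp_hasDerivAt s
      (AffineMap.hasDerivAt_lineMap (a := p) (b := q) (x := s))
    rwa [h0 _ (hmem s hs)] at h1
  have := constant_of_has_deriv_right_zero (f := fun s : ℝ => f (AffineMap.lineMap p q s))
    (fun s hs => (hd s hs).continuousAt.continuousWithinAt)
    (fun s hs => (hd s (Set.Ico_subset_Icc_self hs)).hasDerivWithinAt) 1 (by simp)
  simpa using this.symm

theorem sigma3_kronecker_one_mulVec (s : Spinor) (a b : Fin 2) :
    ((sigma3 ⊗ₖ (1 : Matrix (Fin 2) (Fin 2) ℂ)) *ᵥ s) (a, b) = (chirality a : ℂ) * s (a, b) := by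
  fin_cases a <;> fin_cases b <;>
    simp [Matrix.mulVec, dotProduct, Fintype.sum_prod_type, sigma3, chirality]

theorem one_kronecker_sigma3_mulVec (s : Spinor) (a b : Fin 2) :
    (((1 : Matrix (Fin 2) (Fin 2) ℂ) ⊗ₖ sigma3) *ᵥ s) (a, b) = (chirality b : ℂ) * s (a, b) := by
  fin_cases a <;> fin_cases b <;>
    simp [Matrix.mulVec, dotProduct, Fintype.sum_prod_type, sigma3, chirality]

/-! ### Transport along characteristics -/

section Solution

variable {k : ℕ} {g₁ g₂ : ℝ × ℝ → Spinor} {ψ : Config → Spinor}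

theorem IsSolution.differentiableAt (hψ : IsSolution k g₁ g₂ ψ) (hk : 1 ≤ k) {p : Config}
    (hp : p ∈ Omega) : DifferentiableAt ℝ ψ p :=
  (hψ.contDiffOn.contDiffAt (isOpen_Omega.mem_nhds hp)).differentiableAt (by
    exact_mod_cast (by omega : k ≠ 0))

/-- Each component is transported along the characteristics of both equations. -/
theorem IsSolution.fderiv_characteristic (hψ : IsSolution k g₁ g₂ ψ) (a b : Fin 2) {p : Config}
    (hp : p ∈ Omega) (c d : ℝ) :
    fderiv ℝ ψ p ((c, chirality a * c), (d, chirality b * d)) (a, b) = 0 := by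
  have e : (((c, chirality a * c), (d, chirality b * d)) : Config) =
      c • ((1, 0), (0, 0)) + (chirality a * c) • ((0, 1), (0, 0)) +
      (d • ((0, 0), (1, 0)) + (chirality b * d) • ((0, 0), (0, 1))) := by
    ext <;> simp
  have h1 := congrFun (hψ.dirac₁ p hp) (a, b)
  have h2 := congrFun (hψ.dirac₂ p hp) (a, b)
  simp only [Pi.smul_apply, smul_eq_mul, sigma3_kronecker_one_mulVec,
    one_kronecker_sigma3_mulVec, neg_mul, ← mul_neg] at h1 h2
  have h1' := mul_left_cancel₀ Complex.I_ne_zero h1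
  have h2' := mul_left_cancel₀ Complex.I_ne_zero h2
  rw [e]
  simp only [map_add, map_smul, Pi.add_apply, Pi.smul_apply, h1', h2', Complex.real_smul]
  push_cast
  ring

/-- The segment from `p` to `q` has a characteristic direction for the component `(a, b)`, and
convexity keeps it inside the region. -/
theorem IsSolution.apply_eq_of_nullCoord_eq (hψ : IsSolution k g₁ g₂ ψ) (hk : 1 ≤ k) {σ : ℝ}
    (a b : Fin 2) {p q : Config} (hp : p ∈ region σ) (hq : q ∈ region σ)
    (h₁ : nullCoord a p.1 = nullCoord a q.1) (h₂ : nullCoord b p.2 = nullCoord b q.2) :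
    ψ p (a, b) = ψ q (a, b) := by
  have hd : ∀ x ∈ region σ, DifferentiableAt ℝ ψ x := fun x hx =>
    hψ.differentiableAt hk (region_subset_Omega σ hx)
  refine eq_of_fderiv_sub_eq_zero (f := fun p => ψ p (a, b)) (convex_region σ) hp hq
    (fun x hx => differentiableAt_pi.1 (hd x hx) (a, b)) fun x hx => ?_
  have e : q - p = ((q.1.1 - p.1.1, chirality a * (q.1.1 - p.1.1)),
      (q.2.1 - p.2.1, chirality b * (q.2.1 - p.2.1))) := by
    simp only [nullCoord] at h₁ h₂
    ext <;> simp <;> linarith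
  rw [fderiv_apply (hd x hx), e]
  exact hψ.fderiv_characteristic a b (region_subset_Omega σ hx) _ _

/-- The components `ψ₂`, `ψ₃` are restrictions of `C^k` functions of two null coordinates that are
defined on the whole plane. -/
theorem IsSolution.exists_profiles (hψ : IsSolution k g₁ g₂ ψ) (hk : 1 ≤ k) {σ : ℝ} (hσ : σ ≠ 0) :
    ∃ H K : ℝ × ℝ → ℂ, ContDiff ℝ k H ∧ ContDiff ℝ k K ∧ ∀ p ∈ region σ,
      ψ p (0, 1) = H (nullCoord 0 p.1, nullCoord 1 p.2) ∧
      ψ p (1, 0) = K (nullCoord 0 p.2, nullCoord 1 p.1) := by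
  have hσ2 : 0 < σ * σ := mul_self_pos.2 hσ
  -- With `(u₁, v₂) = w` prescribed, the free coordinates `v₁ = v₂ - σ` and `u₂ = u₁ + σ` make both
  -- null differences equal to `σ`. For `K` the prescribed pair is `(u₂, v₁)`.
  have hH : ∀ w : ℝ × ℝ,
      ((ofNull w.1 (w.2 - σ), ofNull (w.1 + σ) w.2) : Config) ∈ region σ := fun w => by
    simp [region, hσ2]
  have hK : ∀ w : ℝ × ℝ,
      ((ofNull (w.1 - σ) w.2, ofNull w.1 (w.2 + σ)) : Config) ∈ region σ := fun w => by
    simp [region, hσ2]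
  refine ⟨fun w => ψ (ofNull w.1 (w.2 - σ), ofNull (w.1 + σ) w.2) (0, 1),
    fun w => ψ (ofNull (w.1 - σ) w.2, ofNull w.1 (w.2 + σ)) (1, 0), ?_, ?_, fun p hp => ⟨?_, ?_⟩⟩
  · refine (contDiff_pi.1 (hψ.contDiffOn.comp_contDiff ?_
      fun w => region_subset_Omega σ (hH w))) (0, 1)
    simp only [ofNull]
    fun_prop
  · refine (contDiff_pi.1 (hψ.contDiffOn.comp_contDiff ?_
      fun w => region_subset_Omega σ (hK w))) (1, 0)
    simp only [ofNull]
    fun_prop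
  · exact hψ.apply_eq_of_nullCoord_eq hk 0 1 hp (hH _) (by simp) (by simp)
  · exact hψ.apply_eq_of_nullCoord_eq hk 1 0 hp (hK _) (by simp) (by simp)

theorem IsSolution.apply_eq_initial (hψ : IsSolution k g₁ g₂ ψ) (hk : 1 ≤ k) {σ : ℝ}
    {a : Fin 2} {p : Config} (hp : p ∈ region σ) :
    ψ p (a, a) = ψ ((0, nullCoord a p.1), (0, nullCoord a p.2)) (a, a) := by
  refine hψ.apply_eq_of_nullCoord_eq hk a a hp ?_ (by simp [nullCoord]) (by simp [nullCoord])
  obtain ⟨h0, h1⟩ := hp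
  fin_cases a
  · simpa [region] using h0
  · simpa [region] using h1

end Solution

/-! ### The current in components -/

/-- Since `γ⁰γ⁰ = 1` and `γ⁰γ¹ = σ₃`, the current is `ψ† (σ₃^μ ⊗ σ₃^ν) ψ`, which is diagonal. -/
theorem current_eq (ψ : Config → Spinor) (μ ν : Fin 2) (p : Config) :
    current ψ μ ν p = ((∑ a, ∑ b, chirality a ^ (μ : ℕ) * chirality b ^ (ν : ℕ) *
      ‖ψ p (a, b)‖ ^ 2 : ℝ) : ℂ) := by
  have h : ∀ w : ℂ, ((‖w‖ : ℂ)) ^ 2 = (starRingEnd ℂ) w * w := fun w => by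
    rw [mul_comm, Complex.mul_conj, Complex.normSq_eq_norm_sq]; push_cast; rfl
  push_cast
  simp only [h]
  fin_cases μ <;> fin_cases ν <;>
  · simp [current, diracAdjoint, gammaFst, gammaSnd, gamma, sigma1, sigma3, Matrix.mulVec,
      Matrix.vecMul, dotProduct, Fintype.sum_prod_type, Matrix.mul_apply, Fin.sum_univ_two,
      chirality, Matrix.kroneckerMap_apply]
    try ring

theorem antisymCurrent_eq (ψ : Config → Spinor) (p : Config) :
    antisymCurrent ψ p = ((2 * (‖ψ p (1, 0)‖ ^ 2 - ‖ψ p (0, 1)‖ ^ 2) : ℝ) : ℂ) := by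
  simp [antisymCurrent, current_eq, leviCivita, Fin.sum_univ_two, chirality]
  ring

theorem exists_phase {a b : ℂ} (h : ‖a‖ = ‖b‖) :
    ∃ θ ∈ Set.Ico (-Real.pi) Real.pi, a = Complex.exp (-Complex.I * (θ : ℝ)) * b := by
  by_cases hb : b = 0
  · subst hb
    exact ⟨0, ⟨by linarith [Real.pi_pos], Real.pi_pos⟩, by simpa using h⟩
  -- The sign turns the range `(-π, π]` of `arg` into the required `[-π, π)`.
  · refine ⟨-(a / b).arg, ⟨by linarith [Complex.arg_le_pi (a / b)],
      by linarith [Complex.neg_pi_lt_arg (a / b)]⟩, ?_⟩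
    have h1 : ‖a / b‖ = 1 := by rw [norm_div, h, div_self (norm_ne_zero_iff.2 hb)]
    have h2 := Complex.norm_mul_exp_arg_mul_I (a / b)
    rw [h1, Complex.ofReal_one, one_mul] at h2
    rw [Complex.ofReal_neg, neg_mul_neg, mul_comm Complex.I, h2, div_mul_cancel₀ _ hb]

/-! ### Conditions at the coincidence points -/

/-- The common form of `HasLimit₁` (`σ = 1`) and `HasLimit₂` (`σ = -1`). -/
def HasLimit {X : Type*} [TopologicalSpace X] (σ : ℝ) (f : Config → X) (t z : ℝ) (v : X) : Prop :=
  Filter.Tendsto (fun ε : ℝ => f ((t, z - σ * ε), (t, z + σ * ε))) (𝓝[>] 0) (𝓝 v)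

theorem hasLimit₁_iff {X : Type*} [TopologicalSpace X] {f : Config → X} {t z : ℝ} {v : X} :
    HasLimit₁ f t z v ↔ HasLimit 1 f t z v := by
  simp [HasLimit₁, HasLimit]

theorem hasLimit₂_iff {X : Type*} [TopologicalSpace X] {f : Config → X} {t z : ℝ} {v : X} :
    HasLimit₂ f t z v ↔ HasLimit (-1) f t z v := by
  simp [HasLimit₂, HasLimit, sub_eq_add_neg]

theorem mem_region_of_pos {σ : ℝ} (hσ : σ ≠ 0) (t z : ℝ) {ε : ℝ} (hε : 0 < ε) :
    (((t, z - σ * ε), (t, z + σ * ε)) : Config) ∈ region σ := by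
  have h : 0 < 2 * (σ * σ) * ε := by have := mul_self_pos.2 hσ; positivity
  constructor <;> simp <;> linarith

section Boundary

variable {k : ℕ} {ψ : Config → Spinor} {σ : ℝ} {H K : ℝ × ℝ → ℂ}

/-- Continuity of `H` and `K` across the boundary of the region makes every such limit exist. A
general `F` covers the single components and the antisymmetrized current at once. -/
theorem hasLimit_of_profiles {X : Type*} [TopologicalSpace X] (hσ : σ ≠ 0) (hH : Continuous H)
    (hK : Continuous K)
    (h : ∀ p ∈ region σ, ψ p (0, 1) = H (nullCoord 0 p.1, nullCoord 1 p.2) ∧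
      ψ p (1, 0) = K (nullCoord 0 p.2, nullCoord 1 p.1))
    {F : ℂ → ℂ → X} (hF : Continuous (Function.uncurry F)) (t z : ℝ) :
    HasLimit σ (fun p => F (ψ p (0, 1)) (ψ p (1, 0))) t z
      (F (H (z - t, z + t)) (K (z - t, z + t))) := by
  have hc : Continuous fun ε : ℝ =>
      F (H (z - σ * ε - t, z + σ * ε + t)) (K (z + σ * ε - t, z - σ * ε + t)) :=
    hF.comp (f := fun ε : ℝ =>
      (H (z - σ * ε - t, z + σ * ε + t), K (z + σ * ε - t, z - σ * ε + t))) (by fun_prop)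
  have ht := (hc.tendsto 0).mono_left (nhdsWithin_le_nhds (s := Set.Ioi 0))
  simp only [mul_zero, sub_zero, add_zero] at ht
  refine ht.congr' ?_
  filter_upwards [self_mem_nhdsWithin] with ε hε
  obtain ⟨h1, h2⟩ := h _ (mem_region_of_pos hσ t z hε)
  simp [h1, h2]

theorem HasLimit.unique {X : Type*} [TopologicalSpace X] [T2Space X] {f : Config → X} {t z : ℝ}
    {v w : X} (hv : HasLimit σ f t z v) (hw : HasLimit σ f t z w) : v = w :=
  tendsto_nhds_unique hv hw

theorem currentCondition_iff_norm_eq (hσ : σ ≠ 0) (hH : Continuous H) (hK : Continuous K)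
    (h : ∀ p ∈ region σ, ψ p (0, 1) = H (nullCoord 0 p.1, nullCoord 1 p.2) ∧
      ψ p (1, 0) = K (nullCoord 0 p.2, nullCoord 1 p.1)) :
    (∀ t z : ℝ, HasLimit σ (antisymCurrent ψ) t z 0) ↔ ∀ w, ‖H w‖ = ‖K w‖ := by
  have hl : ∀ t z, HasLimit σ (antisymCurrent ψ) t z
      ((2 * (‖K (z - t, z + t)‖ ^ 2 - ‖H (z - t, z + t)‖ ^ 2) : ℝ) : ℂ) := fun t z => by
    have := hasLimit_of_profiles hσ hH hK h
      (F := fun a b => ((2 * (‖b‖ ^ 2 - ‖a‖ ^ 2) : ℝ) : ℂ))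
      (by unfold Function.uncurry; fun_prop) t z
    simpa only [antisymCurrent_eq, HasLimit] using this
  constructor
  · rintro hc ⟨u, v⟩
    -- Every point `(u, v)` of the plane is reached by a coincidence point, so the condition
    -- controls `H` and `K` everywhere.
    have h1 := (hl ((v - u) / 2) ((u + v) / 2)).unique (hc _ _)
    rw [show (u + v) / 2 - (v - u) / 2 = u by ring, show (u + v) / 2 + (v - u) / 2 = v by ring] at h1
    have h2 : 2 * (‖K (u, v)‖ ^ 2 - ‖H (u, v)‖ ^ 2) = 0 := by exact_mod_cast h1
    refine (sq_eq_sq₀ (norm_nonneg _) (norm_nonneg _)).1 (by linarith)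
  · intro hc t z
    simpa [hc] using hl t z

/-- The common form of `LinearCondition₁` (`σ = 1`) and `LinearCondition₂` (`σ = -1`). -/
def LinearCondition (σ : ℝ) (θ : ℝ × ℝ → ℝ) (ψ : Config → Spinor) : Prop :=
  ∀ t z : ℝ, ∃ a b : ℂ, HasLimit σ (fun p => ψ p (0, 1)) t z a ∧
    HasLimit σ (fun p => ψ p (1, 0)) t z b ∧ a = Complex.exp (-Complex.I * θ (t, z)) * b

theorem linearCondition_iff (hσ : σ ≠ 0) (hH : Continuous H) (hK : Continuous K)
    (h : ∀ p ∈ region σ, ψ p (0, 1) = H (nullCoord 0 p.1, nullCoord 1 p.2) ∧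
      ψ p (1, 0) = K (nullCoord 0 p.2, nullCoord 1 p.1)) (θ : ℝ × ℝ → ℝ) :
    LinearCondition σ θ ψ ↔ ∀ t z,
      H (z - t, z + t) = Complex.exp (-Complex.I * θ (t, z)) * K (z - t, z + t) := by
  have h1 := hasLimit_of_profiles hσ hH hK h (F := fun a _ => a) continuous_fst
  have h2 := hasLimit_of_profiles hσ hH hK h (F := fun _ b => b) continuous_snd
  refine forall₂_congr fun t z => ⟨?_, fun he => ⟨_, _, h1 t z, h2 t z, he⟩⟩
  rintro ⟨a, b, ha, hb, he⟩
  rwa [ha.unique (h1 t z), hb.unique (h2 t z)] at he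

theorem currentCondition_iff_linearCondition (hσ : σ ≠ 0) (hH : Continuous H) (hK : Continuous K)
    (h : ∀ p ∈ region σ, ψ p (0, 1) = H (nullCoord 0 p.1, nullCoord 1 p.2) ∧
      ψ p (1, 0) = K (nullCoord 0 p.2, nullCoord 1 p.1)) :
    (∀ t z : ℝ, HasLimit σ (antisymCurrent ψ) t z 0) ↔
      ∃ θ, IsPhaseFunction θ ∧ LinearCondition σ θ ψ := by
  simp only [currentCondition_iff_norm_eq hσ hH hK h, linearCondition_iff hσ hH hK h]
  constructor
  · intro hn
    choose θ hθ he using fun q : ℝ × ℝ => exists_phase (hn (q.2 - q.1, q.2 + q.1))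
    exact ⟨θ, hθ, fun t z => he (t, z)⟩
  · rintro ⟨θ, -, he⟩ ⟨u, v⟩
    have h1 := congrArg norm (he ((v - u) / 2) ((u + v) / 2))
    rw [show (u + v) / 2 - (v - u) / 2 = u by ring, show (u + v) / 2 + (v - u) / 2 = v by ring,
      norm_mul, Complex.norm_exp] at h1
    simpa using h1

/-- Near a point where `K` does not vanish, the factor `e^{-iθ}` is the quotient `H / K`, whatever
jumps `θ` has. -/
theorem contDiffAt_phase (hσ : σ ≠ 0) (hH : ContDiff ℝ k H) (hK : ContDiff ℝ k K)
    (h : ∀ p ∈ region σ, ψ p (0, 1) = H (nullCoord 0 p.1, nullCoord 1 p.2) ∧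
      ψ p (1, 0) = K (nullCoord 0 p.2, nullCoord 1 p.1)) {θ : ℝ × ℝ → ℝ}
    (hθ : LinearCondition σ θ ψ) {t z : ℝ} {b : ℂ}
    (hb : HasLimit σ (fun p => ψ p (1, 0)) t z b) (hb0 : b ≠ 0) :
    ContDiffAt ℝ k (fun q : ℝ × ℝ => Complex.exp (-Complex.I * θ q)) (t, z) := by
  have he := (linearCondition_iff hσ hH.continuous hK.continuous h θ).1 hθ
  have hbK := hb.unique (hasLimit_of_profiles hσ hH.continuous hK.continuous h
    (F := fun _ b => b) continuous_snd t z)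
  have hH' : ContDiff ℝ k fun q : ℝ × ℝ => H (q.2 - q.1, q.2 + q.1) := hH.comp (by fun_prop)
  have hK' : ContDiff ℝ k fun q : ℝ × ℝ => K (q.2 - q.1, q.2 + q.1) := hK.comp (by fun_prop)
  have hK0 : K (z - t, z + t) ≠ 0 := hbK ▸ hb0
  have hinv : ContDiffAt ℝ k (fun q : ℝ × ℝ => (K (q.2 - q.1, q.2 + q.1))⁻¹) (t, z) :=
    hK'.contDiffAt.inv hK0
  refine (hH'.contDiffAt.mul hinv).congr_of_eventuallyEq ?_
  filter_upwards [hK'.continuous.continuousAt.eventually_ne (x := (t, z)) hK0] with q hq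
  rw [he q.1 q.2, mul_assoc, mul_inv_cancel₀ hq, mul_one]

end Boundary

open MeasureTheory

/-! ### Integration over half-planes -/

/-- The open half-plane `z₁ < z₂` (`σ > 0`) or `z₁ > z₂` (`σ < 0`). -/
def halfPlane (σ : ℝ) : Set (ℝ × ℝ) := {q | 0 < σ * (q.2 - q.1)}

theorem measurableSet_halfPlane (σ : ℝ) : MeasurableSet (halfPlane σ) :=
  (isOpen_lt continuous_const (by fun_prop)).measurableSet

theorem disjoint_halfPlane_neg (σ : ℝ) : Disjoint (halfPlane σ) (halfPlane (-σ)) := by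
  rw [Set.disjoint_left]
  intro q h1 h2
  simp only [halfPlane, Set.mem_ofPred_eq] at h1 h2
  linarith

theorem preimage_swap_halfPlane_neg (σ : ℝ) : Prod.swap ⁻¹' halfPlane (-σ) = halfPlane σ := by
  ext q
  simp only [halfPlane, Set.mem_preimage, Set.mem_ofPred_eq, Prod.fst_swap, Prod.snd_swap]
  rw [show -σ * (q.1 - q.2) = σ * (q.2 - q.1) by ring]

theorem halfPlane_union_neg_ae_eq_univ {σ : ℝ} (hσ : σ ≠ 0) :
    (halfPlane σ ∪ halfPlane (-σ) : Set (ℝ × ℝ)) =ᵐ[volume] Set.univ := by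
  rw [ae_eq_univ]
  have hs : MeasurableSet (halfPlane σ ∪ halfPlane (-σ))ᶜ :=
    ((measurableSet_halfPlane σ).union (measurableSet_halfPlane (-σ))).compl
  rw [Measure.volume_eq_prod, Measure.measure_prod_null hs]
  refine Filter.Eventually.of_forall fun x => ?_
  -- The complement is contained in the diagonal, which meets each vertical line in one point.
  refine measure_mono_null (t := {x}) (fun y hy => ?_) (by simp)
  by_contra hne
  apply hy
  simp only [halfPlane, Set.mem_union, Set.mem_ofPred_eq]
  have : σ * (y - x) ≠ 0 := mul_ne_zero hσ (sub_ne_zero.2 hne)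
  rcases this.lt_or_gt with h | h
  · right; linarith
  · left; exact h

theorem integrable_of_integrableOn_halfPlanes {σ : ℝ} (hσ : σ ≠ 0) {f : ℝ × ℝ → ℝ}
    (h₁ : IntegrableOn f (halfPlane σ)) (h₂ : IntegrableOn f (halfPlane (-σ))) :
    Integrable f := by
  rw [← integrableOn_univ]
  exact (h₁.union h₂).congr_set_ae (halfPlane_union_neg_ae_eq_univ hσ).symm

theorem integral_halfPlane_add_neg {σ : ℝ} (hσ : σ ≠ 0) {f : ℝ × ℝ → ℝ} (hf : Integrable f) :
    (∫ q in halfPlane σ, f q) + ∫ q in halfPlane (-σ), f q = ∫ q, f q := by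
  rw [← setIntegral_union (disjoint_halfPlane_neg σ) (measurableSet_halfPlane (-σ))
    hf.integrableOn hf.integrableOn, setIntegral_congr_set (halfPlane_union_neg_ae_eq_univ hσ),
    setIntegral_univ]

theorem integrableOn_halfPlane_comp_swap_iff {σ : ℝ} {f : ℝ × ℝ → ℝ} :
    IntegrableOn (fun q => f q.swap) (halfPlane σ) ↔ IntegrableOn f (halfPlane (-σ)) := by
  rw [← preimage_swap_halfPlane_neg]
  exact (Measure.measurePreserving_swap (μ := (volume : Measure ℝ)) (ν := (volume : Measure ℝ)))
    |>.integrableOn_comp_preimage MeasurableEquiv.prodComm.measurableEmbedding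

theorem integral_halfPlane_comp_swap (σ : ℝ) (f : ℝ × ℝ → ℝ) :
    ∫ q in halfPlane σ, f q.swap = ∫ q in halfPlane (-σ), f q := by
  rw [← preimage_swap_halfPlane_neg]
  exact (Measure.measurePreserving_swap (μ := (volume : Measure ℝ)) (ν := (volume : Measure ℝ)))
    |>.setIntegral_preimage_emb MeasurableEquiv.prodComm.measurableEmbedding f _

/-- Continuity up to the boundary bounds the datum on the compact set `K ∩ H`, off which it
vanishes. -/
theorem IsInitialDatum.integrableOn_norm_sq {k : ℕ} {H : Set (ℝ × ℝ)} {g : ℝ × ℝ → Spinor}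
    (hg : IsInitialDatum k H g) (hH : IsClosed H) (i : Fin 2 × Fin 2) :
    IntegrableOn (fun q => ‖g q i‖ ^ 2) H := by
  obtain ⟨hc, K, hK, h0⟩ := hg
  have hgi : ContinuousOn (fun q => ‖g q i‖ ^ 2) (K ∩ H) :=
    (((continuousOn_pi.1 hc.continuousOn) i).norm.pow 2).mono Set.inter_subset_right
  refine (hgi.integrableOn_compact (hK.inter_right hH)).of_forall_sdiff_eq_zero hH.measurableSet ?_
  rintro q ⟨hq, hqK⟩
  rw [h0 q hq fun h => hqK ⟨h, hq⟩]
  simp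

/-- Change of variables by a product of two increasing diffeomorphisms of the line. -/
theorem prodMap_change_of_variables {P Q P' Q' : ℝ → ℝ}
    (hP : ∀ x, HasDerivAt P (P' x) x) (hQ : ∀ x, HasDerivAt Q (Q' x) x)
    (hP0 : ∀ x, 0 ≤ P' x) (hQ0 : ∀ x, 0 ≤ Q' x) (hPi : P.Injective) (hQi : Q.Injective)
    {s : Set (ℝ × ℝ)} (hs : MeasurableSet s) (f : ℝ × ℝ → ℝ) :
    (IntegrableOn f (Prod.map P Q '' s) ↔
      IntegrableOn (fun q => f (P q.1, Q q.2) * (P' q.1 * Q' q.2)) s) ∧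
    ∫ q in Prod.map P Q '' s, f q = ∫ q in s, f (P q.1, Q q.2) * (P' q.1 * Q' q.2) := by
  let D : ℝ × ℝ → (ℝ × ℝ →L[ℝ] ℝ × ℝ) := fun q =>
    (ContinuousLinearMap.toSpanSingleton ℝ (P' q.1)).prodMap
      (ContinuousLinearMap.toSpanSingleton ℝ (Q' q.2))
  have hD : ∀ q ∈ s, HasFDerivWithinAt (Prod.map P Q) (D q) s q := fun q _ =>
    (HasFDerivAt.prodMap q (hP q.1).hasFDerivAt (hQ q.2).hasFDerivAt).hasFDerivWithinAt
  have hdet : ∀ q, |(D q).det| = P' q.1 * Q' q.2 := fun q => by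
    have h1 : (D q).det = P' q.1 * Q' q.2 := by
      have := LinearMap.det_prodMap (LinearMap.toSpanSingleton ℝ ℝ (P' q.1))
        (LinearMap.toSpanSingleton ℝ ℝ (Q' q.2))
      rw [LinearMap.det_ring, LinearMap.det_ring] at this
      simp only [LinearMap.toSpanSingleton_apply, smul_eq_mul, one_mul] at this
      exact this
    rw [h1, abs_of_nonneg (mul_nonneg (hP0 _) (hQ0 _))]
  have hinj : Set.InjOn (Prod.map P Q) s := (hPi.prodMap hQi).injOn
  have h1 := integrableOn_image_iff_integrableOn_abs_det_fderiv_smul volume hs hD hinj f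
  have h2 := integral_image_eq_integral_abs_det_fderiv_smul volume hs hD hinj f
  simp only [hdet, smul_eq_mul, Prod.map] at h1 h2
  simp only [mul_comm (f _)]
  exact ⟨h1, h2⟩

/-! ### The current form on a Cauchy surface -/

namespace SpacelikeCauchySurface

variable (S : SpacelikeCauchySurface)

/-- A null coordinate along the surface. -/
def null (a : Fin 2) (z : ℝ) : ℝ := nullCoord a (S.time z, z)

/-- The derivative of a null coordinate along the surface. -/
def nullDeriv (a : Fin 2) (z : ℝ) : ℝ := 1 - chirality a * deriv S.time z

theorem hasDerivAt_time (z : ℝ) : HasDerivAt S.time (deriv S.time z) z :=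
  (S.smooth.differentiable (by simp)).differentiableAt.hasDerivAt

theorem hasDerivAt_null (a : Fin 2) (z : ℝ) : HasDerivAt (S.null a) (S.nullDeriv a z) z :=
  (hasDerivAt_id z).sub ((S.hasDerivAt_time z).const_mul _)

theorem nullDeriv_pos (a : Fin 2) (z : ℝ) : 0 < S.nullDeriv a z := by
  have := abs_lt.1 (S.spacelike z)
  fin_cases a <;> simp [nullDeriv, chirality] <;> linarith

theorem strictMono_null (a : Fin 2) : StrictMono (S.null a) :=
  strictMono_of_deriv_pos fun z => by
    rw [(S.hasDerivAt_null a z).deriv]; exact S.nullDeriv_pos a z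

/-- This is where the Cauchy property enters: the light ray through `(0, u)` on which the null
coordinate is constantly `u` meets the surface. -/
theorem surjective_null (a : Fin 2) : (S.null a).Surjective := by
  intro u
  fin_cases a
  · obtain ⟨s, hs⟩ := S.meets_right 0 u
    exact ⟨u + s, by simp [null, hs]⟩
  · obtain ⟨s, hs⟩ := S.meets_left 0 u
    exact ⟨u - s, by simp [null, hs]⟩

theorem mul_null_sub_pos_iff (a : Fin 2) (σ x y : ℝ) :
    0 < σ * (S.null a y - S.null a x) ↔ 0 < σ * (y - x) := by
  simp only [mul_pos_iff, sub_pos, sub_neg, (S.strictMono_null a).lt_iff_lt]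

theorem param_mem_region_iff {σ : ℝ} {q : ℝ × ℝ} : S.param q ∈ region σ ↔ q ∈ halfPlane σ := by
  change 0 < σ * (S.null 0 q.2 - S.null 0 q.1) ∧ 0 < σ * (S.null 1 q.2 - S.null 1 q.1) ↔ _
  rw [S.mul_null_sub_pos_iff, S.mul_null_sub_pos_iff, and_self]
  rfl

theorem domain_eq : S.domain = halfPlane 1 ∪ halfPlane (-1) := by
  ext q
  constructor
  · intro hq
    rcases lt_trichotomy q.1 q.2 with h | h | h
    · left; simpa [halfPlane] using h
    · simp [domain, param, Omega, h] at hq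
    · right; simpa [halfPlane] using h
  · rintro (h | h)
    · exact region_subset_Omega 1 (S.param_mem_region_iff.2 h)
    · exact region_subset_Omega (-1) (S.param_mem_region_iff.2 h)

theorem image_null_halfPlane (a : Fin 2) (σ : ℝ) :
    Prod.map (S.null a) (S.null a) '' halfPlane σ = halfPlane σ := by
  ext q
  constructor
  · rintro ⟨x, hx, rfl⟩
    exact (S.mul_null_sub_pos_iff a σ x.1 x.2).2 hx
  · intro hq
    obtain ⟨x, hx⟩ := S.surjective_null a q.1
    obtain ⟨y, hy⟩ := S.surjective_null a q.2
    refine ⟨(x, y), (S.mul_null_sub_pos_iff a σ x y).1 ?_, by simp [hx, hy]⟩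
    rw [hx, hy]
    exact hq

theorem hasFDerivAt_param (q : ℝ × ℝ) :
    HasFDerivAt S.param
      ((((ContinuousLinearMap.toSpanSingleton ℝ (deriv S.time q.1)).comp
        (ContinuousLinearMap.fst ℝ ℝ ℝ)).prod (ContinuousLinearMap.fst ℝ ℝ ℝ)).prod
       (((ContinuousLinearMap.toSpanSingleton ℝ (deriv S.time q.2)).comp
        (ContinuousLinearMap.snd ℝ ℝ ℝ)).prod (ContinuousLinearMap.snd ℝ ℝ ℝ))) q :=
  ((HasFDerivAt.comp q (S.hasDerivAt_time q.1).hasFDerivAt hasFDerivAt_fst).prodMk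
    hasFDerivAt_fst).prodMk
    ((HasFDerivAt.comp q (S.hasDerivAt_time q.2).hasFDerivAt hasFDerivAt_snd).prodMk
      hasFDerivAt_snd)

/-- The real density of `ω_j` on `Σ × Σ` with respect to `dz₁ ∧ dz₂`. -/
def density (ψ : Config → Spinor) (q : ℝ × ℝ) : ℝ :=
  ∑ a, ∑ b, ‖ψ (S.param q) (a, b)‖ ^ 2 * (S.nullDeriv a q.1 * S.nullDeriv b q.2)

/-- Along the surface `dt_i = t_Σ'(z_i) dz_i`, so the signs of `ω_j` and the chirality weights of
`j^{μν}` factor into `(1 - χ_a t_Σ'(z₁)) (1 - χ_b t_Σ'(z₂))`. -/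
theorem pullback_currentForm (ψ : Config → Spinor) (q : ℝ × ℝ) :
    S.pullback (currentForm ψ) q = (S.density ψ q : ℂ) := by
  simp [pullback, currentForm, density, (S.hasFDerivAt_param q).fderiv, Fin.sum_univ_two,
    current_eq, wedge_apply, dx, nullDeriv, chirality]
  ring

variable {S}

/-! ### Conservation on each half of `Σ × Σ` -/

section Density

variable {ψ : Config → Spinor} {σ : ℝ} {H K : ℝ × ℝ → ℂ} {k : ℕ} {g₁ g₂ g : ℝ × ℝ → Spinor}

/-- The right-hand side does not involve `S`. The map `u × v` need not preserve the half-plane, so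
the `ψ₂` and `ψ₃` terms are combined into one integral over the plane. -/
theorem integral_density_halfPlane (S : SpacelikeCauchySurface) (hψ : IsSolution k g₁ g₂ ψ)
    (hk : 1 ≤ k) (hσ : σ ≠ 0)
    (hg : IsInitialDatum k {q | 0 ≤ σ * (q.2 - q.1)} g)
    (hi : ∀ q ∈ halfPlane σ, ψ ((0, q.1), (0, q.2)) = g q)
    (h : ∀ p ∈ region σ, ψ p (0, 1) = H (nullCoord 0 p.1, nullCoord 1 p.2) ∧
      ψ p (1, 0) = K (nullCoord 0 p.2, nullCoord 1 p.1))
    (hHK : ∀ w, ‖H w‖ = ‖K w‖) :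
    IntegrableOn (S.density ψ) (halfPlane σ) ∧
      ∫ q in halfPlane σ, S.density ψ q =
        (∫ q in halfPlane σ, ‖g q (0, 0)‖ ^ 2) + (∫ q, ‖H q‖ ^ 2) +
          ∫ q in halfPlane σ, ‖g q (1, 1)‖ ^ 2 := by
  have hgi : ∀ i, IntegrableOn (fun q => ‖g q i‖ ^ 2) (halfPlane σ) := fun i =>
    (hg.integrableOn_norm_sq (isClosed_le continuous_const (by fun_prop)) i).mono_set
      fun q (hq : 0 < σ * (q.2 - q.1)) => hq.le
  have hreg : ∀ q ∈ halfPlane σ, (((0, q.1), (0, q.2)) : Config) ∈ region σ := fun q hq => by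
    simpa [region, halfPlane] using hq
  -- At time zero `ψ₂` gives `H` on one half-plane, while `ψ₃` gives `K`, hence `|H|`, with swapped
  -- arguments on the other.
  have hHi : Integrable fun q => ‖H q‖ ^ 2 := by
    refine integrable_of_integrableOn_halfPlanes hσ
      ((hgi (0, 1)).congr_fun (fun q hq => ?_) (measurableSet_halfPlane σ)) ?_
    · have := (h _ (hreg q hq)).1
      simp only [nullCoord_zero, nullCoord_one, sub_zero, add_zero, hi q hq] at this
      simp only [this]
    · refine integrableOn_halfPlane_comp_swap_iff.1
        ((hgi (1, 0)).congr_fun (fun q hq => ?_) (measurableSet_halfPlane σ))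
      have := (h _ (hreg q hq)).2
      simp only [nullCoord_zero, nullCoord_one, sub_zero, add_zero, hi q hq] at this
      simp only [this, hHK, Prod.swap]
  have hcv := fun (a b : Fin 2) {s : Set (ℝ × ℝ)} (hs : MeasurableSet s) =>
    prodMap_change_of_variables (S.hasDerivAt_null a) (S.hasDerivAt_null b)
      (fun x => (S.nullDeriv_pos a x).le) (fun x => (S.nullDeriv_pos b x).le)
      (S.strictMono_null a).injective (S.strictMono_null b).injective hs
  -- the components `ψ₁` and `ψ₄`
  have hdiag : ∀ a : Fin 2,
      IntegrableOn (fun q => ‖ψ (S.param q) (a, a)‖ ^ 2 * (S.nullDeriv a q.1 * S.nullDeriv a q.2))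
        (halfPlane σ) ∧
      ∫ q in halfPlane σ, ‖ψ (S.param q) (a, a)‖ ^ 2 * (S.nullDeriv a q.1 * S.nullDeriv a q.2) =
        ∫ q in halfPlane σ, ‖g q (a, a)‖ ^ 2 := fun a => by
    have he : Set.EqOn
        (fun q => ‖g (S.null a q.1, S.null a q.2) (a, a)‖ ^ 2 *
          (S.nullDeriv a q.1 * S.nullDeriv a q.2))
        (fun q => ‖ψ (S.param q) (a, a)‖ ^ 2 * (S.nullDeriv a q.1 * S.nullDeriv a q.2))
        (halfPlane σ) := fun q hq => by
      have h1 := hψ.apply_eq_initial hk (a := a) (S.param_mem_region_iff.2 hq)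
      have h2 := hi (S.null a q.1, S.null a q.2) ((S.mul_null_sub_pos_iff a σ q.1 q.2).2 hq)
      have h3 : ψ (S.param q) (a, a) = g (S.null a q.1, S.null a q.2) (a, a) := by
        rw [h1, ← h2]; rfl
      simp only [h3]
    obtain ⟨h1, h2⟩ := hcv a a (measurableSet_halfPlane σ) fun q => ‖g q (a, a)‖ ^ 2
    rw [S.image_null_halfPlane] at h1 h2
    exact ⟨(h1.1 (hgi _)).congr_fun he (measurableSet_halfPlane σ),
      by rw [h2, setIntegral_congr_fun (measurableSet_halfPlane σ) he]⟩
  -- the components `ψ₂` and `ψ₃`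
  let w : ℝ × ℝ → ℝ := fun q =>
    ‖H (S.null 0 q.1, S.null 1 q.2)‖ ^ 2 * (S.nullDeriv 0 q.1 * S.nullDeriv 1 q.2)
  -- On the whole plane `u × v` is a bijection, so the integral of `w` is `∫ |H|²`.
  obtain ⟨hwi, hwint⟩ := hcv 0 1 MeasurableSet.univ fun q => ‖H q‖ ^ 2
  rw [Set.image_univ, ((S.surjective_null 0).prodMap (S.surjective_null 1)).range_eq] at hwi hwint
  simp only [integrableOn_univ, setIntegral_univ] at hwi hwint
  have hw : Integrable w := hwi.1 hHi
  have h01 : Set.EqOn w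
      (fun q => ‖ψ (S.param q) (0, 1)‖ ^ 2 * (S.nullDeriv 0 q.1 * S.nullDeriv 1 q.2))
      (halfPlane σ) := fun q hq => by
    have h1 := (h _ (S.param_mem_region_iff.2 hq)).1
    simp only [h1]
    rfl
  have h10 : Set.EqOn (fun q => w q.swap)
      (fun q => ‖ψ (S.param q) (1, 0)‖ ^ 2 * (S.nullDeriv 1 q.1 * S.nullDeriv 0 q.2))
      (halfPlane σ) := fun q hq => by
    have h1 := (h _ (S.param_mem_region_iff.2 hq)).2
    simp only [h1, ← hHK, mul_comm (S.nullDeriv 1 q.1)]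
    rfl
  have i01 := hw.integrableOn.congr_fun h01 (measurableSet_halfPlane σ)
  have i10 := (integrableOn_halfPlane_comp_swap_iff.2 hw.integrableOn).congr_fun h10
    (measurableSet_halfPlane σ)
  -- The integral over the opposite half-plane becomes, after the swap, the `ψ₃` contribution.
  have hoff := integral_halfPlane_add_neg hσ hw
  rw [← integral_halfPlane_comp_swap, setIntegral_congr_fun (measurableSet_halfPlane σ) h01,
    setIntegral_congr_fun (measurableSet_halfPlane σ) h10] at hoff
  obtain ⟨i00, e00⟩ := hdiag 0
  obtain ⟨i11, e11⟩ := hdiag 1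
  have hden : S.density ψ = fun q =>
      (‖ψ (S.param q) (0, 0)‖ ^ 2 * (S.nullDeriv 0 q.1 * S.nullDeriv 0 q.2) +
        ‖ψ (S.param q) (0, 1)‖ ^ 2 * (S.nullDeriv 0 q.1 * S.nullDeriv 1 q.2)) +
      (‖ψ (S.param q) (1, 0)‖ ^ 2 * (S.nullDeriv 1 q.1 * S.nullDeriv 0 q.2) +
        ‖ψ (S.param q) (1, 1)‖ ^ 2 * (S.nullDeriv 1 q.1 * S.nullDeriv 1 q.2)) := by
    funext q
    simp only [density, Fin.sum_univ_two]
  rw [hden]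
  refine ⟨(i00.add i01).add (i10.add i11), ?_⟩
  have hsum := integral_add (i00.add i01) (i10.add i11)
  simp only [Pi.add_apply] at hsum
  rw [hsum, integral_add i00 i01, integral_add i10 i11, e00, e11, hwint]
  linarith

end Density

end SpacelikeCauchySurface

theorem probabilityConserved_of_density {ψ : Config → Spinor} {c₁ c₂ : ℝ}
    (h₁ : ∀ S : SpacelikeCauchySurface, IntegrableOn (S.density ψ) (halfPlane 1) ∧
      ∫ q in halfPlane 1, S.density ψ q = c₁)
    (h₂ : ∀ S : SpacelikeCauchySurface, IntegrableOn (S.density ψ) (halfPlane (-1)) ∧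
      ∫ q in halfPlane (-1), S.density ψ q = c₂) :
    ProbabilityConserved ψ := by
  have hint : ∀ S : SpacelikeCauchySurface, S.integral (currentForm ψ) = ((c₁ + c₂ : ℝ) : ℂ) :=
    fun S => by
      rw [SpacelikeCauchySurface.integral, S.domain_eq]
      simp only [S.pullback_currentForm]
      rw [integral_complex_ofReal, setIntegral_union (disjoint_halfPlane_neg 1)
        (measurableSet_halfPlane (-1)) (h₁ S).1 (h₂ S).1, (h₁ S).2, (h₂ S).2]
  refine ⟨fun S => ?_, fun S S' => by rw [hint, hint]⟩
  rw [S.domain_eq, funext (S.pullback_currentForm ψ)]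
  exact ((h₁ S).1.union (h₂ S).1).ofReal

end TwoTimeDirac
end

/-! ### Assembly: `σ = 1` for `Ω₁` and `σ = -1` for `Ω₂` -/

theorem mainTheorem2 (k : ℕ) (hk : 1 ≤ k)
    (g₁ g₂ : ℝ × ℝ → TwoTimeDirac.Spinor) (ψ : TwoTimeDirac.Config → TwoTimeDirac.Spinor)
    (hg₁ : TwoTimeDirac.IsInitialDatum k {q | q.1 ≤ q.2} g₁)
    (hg₂ : TwoTimeDirac.IsInitialDatum k {q | q.2 ≤ q.1} g₂)
    (hψ : TwoTimeDirac.IsSolution k g₁ g₂ ψ) :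
    -- the current conditions guarantee probability conservation
    (TwoTimeDirac.CurrentCondition₁ ψ → TwoTimeDirac.CurrentCondition₂ ψ →
      TwoTimeDirac.ProbabilityConserved ψ) ∧
    -- the current conditions are equivalent to the linear boundary conditions
    (TwoTimeDirac.CurrentCondition₁ ψ ↔
      ∃ θ₁, TwoTimeDirac.IsPhaseFunction θ₁ ∧ TwoTimeDirac.LinearCondition₁ θ₁ ψ) ∧
    (TwoTimeDirac.CurrentCondition₂ ψ ↔
      ∃ θ₂, TwoTimeDirac.IsPhaseFunction θ₂ ∧ TwoTimeDirac.LinearCondition₂ θ₂ ψ) ∧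
    -- the phases are `C^k` modulo `2π` wherever they are determined by `ψ`
    (∀ θ₁, TwoTimeDirac.IsPhaseFunction θ₁ → TwoTimeDirac.LinearCondition₁ θ₁ ψ →
      ∀ (t z : ℝ) (b : ℂ), TwoTimeDirac.HasLimit₁ (fun p => ψ p (1, 0)) t z b → b ≠ 0 →
        ContDiffAt ℝ k (fun q : ℝ × ℝ => Complex.exp (-Complex.I * θ₁ q)) (t, z)) ∧
    (∀ θ₂, TwoTimeDirac.IsPhaseFunction θ₂ → TwoTimeDirac.LinearCondition₂ θ₂ ψ →
      ∀ (t z : ℝ) (b : ℂ), TwoTimeDirac.HasLimit₂ (fun p => ψ p (1, 0)) t z b → b ≠ 0 →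
        ContDiffAt ℝ k (fun q : ℝ × ℝ => Complex.exp (-Complex.I * θ₂ q)) (t, z)) := by
  have hσ : (-1 : ℝ) ≠ 0 := by norm_num
  obtain ⟨H₁, K₁, hH₁, hK₁, h₁⟩ := hψ.exists_profiles hk one_ne_zero
  obtain ⟨H₂, K₂, hH₂, hK₂, h₂⟩ := hψ.exists_profiles hk hσ
  have l₁ : ∀ θ, TwoTimeDirac.LinearCondition₁ θ ψ ↔ TwoTimeDirac.LinearCondition 1 θ ψ :=
    fun θ => by
      simp only [TwoTimeDirac.LinearCondition₁, TwoTimeDirac.LinearCondition,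
        TwoTimeDirac.hasLimit₁_iff]
  have l₂ : ∀ θ, TwoTimeDirac.LinearCondition₂ θ ψ ↔ TwoTimeDirac.LinearCondition (-1) θ ψ :=
    fun θ => by
      simp only [TwoTimeDirac.LinearCondition₂, TwoTimeDirac.LinearCondition,
        TwoTimeDirac.hasLimit₂_iff]
  simp only [l₁, l₂, TwoTimeDirac.CurrentCondition₁, TwoTimeDirac.CurrentCondition₂,
    TwoTimeDirac.hasLimit₁_iff, TwoTimeDirac.hasLimit₂_iff]
  refine ⟨fun hc₁ hc₂ => ?_, ?_, ?_, ?_, ?_⟩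
  · rw [TwoTimeDirac.currentCondition_iff_norm_eq one_ne_zero hH₁.continuous hK₁.continuous h₁]
      at hc₁
    rw [TwoTimeDirac.currentCondition_iff_norm_eq hσ hH₂.continuous hK₂.continuous h₂] at hc₂
    refine TwoTimeDirac.probabilityConserved_of_density
      (fun S => S.integral_density_halfPlane hψ hk one_ne_zero (g := g₁) ?_ ?_ h₁ hc₁)
      (fun S => S.integral_density_halfPlane hψ hk hσ (g := g₂) ?_ ?_ h₂ hc₂)
    · simpa using hg₁
    · intro q hq
      exact hψ.initial₁ q.1 q.2 (by simpa [TwoTimeDirac.halfPlane] using hq)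
    · simpa using hg₂
    · intro q hq
      exact hψ.initial₂ q.1 q.2 (by simpa [TwoTimeDirac.halfPlane] using hq)
  · exact TwoTimeDirac.currentCondition_iff_linearCondition one_ne_zero hH₁.continuous
      hK₁.continuous h₁
  · exact TwoTimeDirac.currentCondition_iff_linearCondition hσ hH₂.continuous hK₂.continuous h₂
  · exact fun θ _ hl t z b hb hb0 =>
      TwoTimeDirac.contDiffAt_phase one_ne_zero hH₁ hK₁ h₁ hl hb hb0
  · exact fun θ _ hl t z b hb hb0 => TwoTimeDirac.contDiffAt_phase hσ hH₂ hK₂ h₂ hl hb hb0
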